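/- Let $H$ be a closed subgroup of a locally compact Hausdorff abelian group $G$ (written additively), let $D$ and $E$ be $C^*$-algebras, let $\alpha : H \to \operatorname{Aut} D$ and $\gamma : G \to \operatorname{Aut} E$ be strongly continuous actions (i.e. $g \mapsto \gamma_g(e)$ is norm continuous for each $e$, and similarly for $\alpha$), let $\rho : E \to D$ be a surjective $*$-homomorphism, and let $i : C_0(G/H) \to Z(M(E))$ be a $*$-homomorphism into the centre of the multiplier algebra of $E$ which is $G$-equivariant: $i(\tau_g(k)) = \gamma_g(i(k))$, where $\tau_g(k)(x+H) = k(x-g+H)$ and $\gamma_g$ also denotes the canonical extension of $\gamma_g$ to $M(E)$. Let $\operatorname{ind}_H^G(D,\alpha)$ be the $C^*$-algebra (pointwise operations, supremum norm) of all continuous $f : G \to D$ such that $f(x-h) = \alpha_h(f(x))$ for all $h \in H$, $x \in G$ and such that $x+H \mapsto \|f(x)\|$ belongs to $C_0(G/H)$. Let $\beta_g(f)(x) = f(x-g)$ be the translation action of $G$ on it, let $\pi : \operatorname{ind}_H^G(D,\alpha) \to D$, $\pi(f) = f(0)$, and let $j : C_0(G/H) \to M(\operatorname{ind}_H^G(D,\alpha))$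 be given by pointwise multiplication, $(j(k)f)(x) = k(x+H)f(x)$. Suppose that (i) $\rho(i(k)e) = k(H)\rho(e)$ for all $k \in C_0(G/H)$ and $e \in E$; (ii) $\rho(\gamma_h(e)) = \alpha_h(\rho(e))$ for all $h \in H$ and $e \in E$; (iii) if $e \in E$ and $\rho(\gamma_g(e)) = 0$ for all $g \in G$, then $e = 0$; (iv) $\lim_{x+H \to \infty} \|\rho(\gamma_x(e))\| = 0$ for all $e \in E$. Then there is a $*$-isomorphism $\Psi : E \to \operatorname{ind}_H^G(D,\alpha)$ which is $G$-equivariant ($\Psi(\gamma_g(e)) = \beta_g(\Psi(e))$ for all $g \in G$, $e \in E$) and satisfies $\pi \circ \Psi = \rho$ and $j(k)\Psi(e) = \Psi(i(k)e)$ for all $k \in C_0(G/H)$ and $e \in E$. Moreover, $\Psi$ is the only $G$-equivariant $*$-isomorphism $E \to \operatorname{ind}_H^G(D,\alpha)$ with $\pi \circ \Psi = \rho$. -/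

import Mathlib

open Filter Topology
open scoped ZeroAtInfty BoundedContinuousFunction MultiplierAlgebra

namespace InducedAlgebra

set_option linter.unusedSectionVars false

noncomputable section

/-- A strongly continuous action of a topological (additive) group `G` on a C⋆-algebra `A`:
a homomorphism `G → Aut A` such that `g ↦ γ_g a` is norm continuous for each `a`. -/
structure CStarAction (G A : Type*) [AddGroup G] [TopologicalSpace G]
    [NonUnitalCStarAlgebra A] where
  /-- The automorphism attached to a group element. -/
  aut : G → (A ≃⋆ₐ[ℂ] A)
  map_zero : aut 0 = 1
  map_add : ∀ g h, aut (g + h) = aut g * aut h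
  continuous_apply : ∀ a : A, Continuous fun g => aut g a

instance {G A : Type*} [AddGroup G] [TopologicalSpace G] [NonUnitalCStarAlgebra A] :
    CoeFun (CStarAction G A) (fun _ => G → (A ≃⋆ₐ[ℂ] A)) := ⟨CStarAction.aut⟩

/-- A ⋆-automorphism of a C⋆-algebra as a continuous linear map. -/
def autCLM {A : Type*} [NonUnitalCStarAlgebra A] (φ : A ≃⋆ₐ[ℂ] A) : A →L[ℂ] A where
  toFun := φ
  map_add' := map_add φ
  map_smul' := map_smul φ
  cont := (StarAlgEquiv.isometry φ).continuous

/-- The canonical extension of an automorphism `φ` of `A` to the multiplier algebra `M(A)`: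
it sends `m = (L, R)` to `(φ ∘ L ∘ φ⁻¹, φ ∘ R ∘ φ⁻¹)`, so that `φ(m) φ(a) = φ(m a)`. -/
def multiplierAut {A : Type*} [NonUnitalCStarAlgebra A] (φ : A ≃⋆ₐ[ℂ] A) (m : 𝓜(ℂ, A)) :
    𝓜(ℂ, A) where
  fst := (autCLM φ).comp (m.fst.comp (autCLM φ.symm))
  snd := (autCLM φ).comp (m.snd.comp (autCLM φ.symm))
  central x y := by
    change φ (m.snd (φ.symm x)) * y = x * φ (m.fst (φ.symm y))
    have h := congrArg φ (m.central (φ.symm x) (φ.symm y))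
    simpa only [map_mul, StarAlgEquiv.apply_symm_apply] using h

section

variable {G : Type*} [AddCommGroup G] [TopologicalSpace G] [IsTopologicalAddGroup G]
variable (H : AddSubgroup G)

/-- The translation `τ_g` on `C₀(G/H)`: `τ_g(k)(x + H) = k(x - g + H)`. -/
def translateC0 (g : G) (k : C₀(G ⧸ H, ℂ)) : C₀(G ⧸ H, ℂ) :=
  k.comp (Homeomorph.subRight (g : G ⧸ H)).toCocompactMap

theorem translateC0_apply (g x : G) (k : C₀(G ⧸ H, ℂ)) :
    translateC0 H g k (x : G ⧸ H) = k ((x - g : G) : G ⧸ H) := rfl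

variable {H} {D : Type*} [NonUnitalCStarAlgebra D] (α : CStarAction H D)

theorem norm_aut {A : Type*} [NonUnitalCStarAlgebra A] (φ : A ≃⋆ₐ[ℂ] A) (a : A) :
    ‖φ a‖ = ‖a‖ := StarAlgEquiv.norm_map φ a

/-- For a continuous `f` with `f(x - h) = α_h(f(x))`, the function `x + H ↦ ‖f(x)‖` lies in
`C₀(G/H)` if and only if `‖f(x)‖ → 0` as `x + H → ∞`. -/
theorem exists_C0_iff {f : G → D} (hf : Continuous f)
    (hcov : ∀ (x : G) (h : H), f (x - h) = α h (f x)) :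
    (∃ k : C₀(G ⧸ H, ℝ), ∀ x : G, k (x : G ⧸ H) = ‖f x‖) ↔
      Tendsto (fun x => ‖f x‖) (comap (fun x : G => (x : G ⧸ H)) (cocompact (G ⧸ H))) (𝓝 0) := by
  constructor
  · rintro ⟨k, hk⟩
    simp only [← hk]
    exact k.zero_at_infty'.comp tendsto_comap
  · intro h
    have hq : ∀ a b : G, QuotientAddGroup.leftRel H a b → ‖f a‖ = ‖f b‖ := by
      intro a b hab
      rw [QuotientAddGroup.leftRel_apply] at hab
      have := hcov b ⟨-a + b, hab⟩
      rw [show b - ((⟨-a + b, hab⟩ : H) : G) = a by simp] at this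
      rw [this, norm_aut]
    refine ⟨⟨⟨fun y => Quotient.lift (fun x => ‖f x‖) hq y, ?_⟩, ?_⟩, fun x => rfl⟩
    · exact hf.norm.quotient_lift hq
    · intro s hs
      obtain ⟨t, ht, hts⟩ := h hs
      refine Filter.mem_map.2 (mem_of_superset ht fun y hy => ?_)
      obtain ⟨x, rfl⟩ := QuotientAddGroup.mk_surjective y
      exact hts hy

/-- The induced C⋆-algebra `ind_H^G(D, α)`: all continuous `f : G → D` such that
`f(x - h) = α_h(f(x))` and `x + H ↦ ‖f(x)‖` belongs to `C₀(G/H)`, with the pointwise operations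
and the supremum norm.  Such functions are automatically bounded
(see `exists_mem_inducedAlgebra`). -/
def inducedAlgebra : NonUnitalStarSubalgebra ℂ (G →ᵇ D) where
  carrier := {f | (∀ (x : G) (h : H), f (x - h) = α h (f x)) ∧
    ∃ k : C₀(G ⧸ H, ℝ), ∀ x : G, k (x : G ⧸ H) = ‖f x‖}
  zero_mem' := ⟨fun x h => by simp, 0, fun x => by simp⟩
  add_mem' := by
    rintro f g ⟨hf, hf'⟩ ⟨hg, hg'⟩
    have hc : ∀ (x : G) (h : H), (f + g) (x - h) = α h ((f + g) x) := by
      intro x h; simp [hf, hg]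
    refine ⟨hc, (exists_C0_iff α (f + g).continuous hc).2 ?_⟩
    have h1 := (exists_C0_iff α f.continuous hf).1 hf'
    have h2 := (exists_C0_iff α g.continuous hg).1 hg'
    have h3 := h1.add h2
    rw [add_zero] at h3
    exact squeeze_zero (fun x => norm_nonneg _) (fun x => norm_add_le (f x) (g x)) h3
  mul_mem' := by
    rintro f g ⟨hf, hf'⟩ ⟨hg, hg'⟩
    have hc : ∀ (x : G) (h : H), (f * g) (x - h) = α h ((f * g) x) := by
      intro x h; simp [hf, hg]
    refine ⟨hc, (exists_C0_iff α (f * g).continuous hc).2 ?_⟩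
    have h1 := (exists_C0_iff α f.continuous hf).1 hf'
    have h2 := (exists_C0_iff α g.continuous hg).1 hg'
    have h3 := h1.mul h2
    rw [mul_zero] at h3
    exact squeeze_zero (fun x => norm_nonneg _) (fun x => norm_mul_le (f x) (g x)) h3
  smul_mem' := by
    rintro c f ⟨hf, hf'⟩
    have hc : ∀ (x : G) (h : H), (c • f) (x - h) = α h ((c • f) x) := by
      intro x h; simp [hf]
    refine ⟨hc, (exists_C0_iff α (c • f).continuous hc).2 ?_⟩
    have h1 := (exists_C0_iff α f.continuous hf).1 hf'
    have h3 := h1.const_mul ‖c‖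
    rw [mul_zero] at h3
    exact squeeze_zero (fun x => norm_nonneg _) (fun x => norm_smul_le c (f x)) h3
  star_mem' := by
    rintro f ⟨hf, k, hk⟩
    refine ⟨fun x h => ?_, k, fun x => ?_⟩
    · simp [hf, map_star]
    · simp [hk]

theorem mem_inducedAlgebra {f : G →ᵇ D} : f ∈ inducedAlgebra α ↔
    (∀ (x : G) (h : H), f (x - h) = α h (f x)) ∧
      ∃ k : C₀(G ⧸ H, ℝ), ∀ x : G, k (x : G ⧸ H) = ‖f x‖ := Iff.rfl

/-- Boundedness is not a restriction in the definition of the induced algebra. -/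
theorem exists_mem_inducedAlgebra (f : C(G, D))
    (hcov : ∀ (x : G) (h : H), f (x - h) = α h (f x))
    (hf : ∃ k : C₀(G ⧸ H, ℝ), ∀ x : G, k (x : G ⧸ H) = ‖f x‖) :
    ∃ F ∈ inducedAlgebra α, ∀ x, F x = f x := by
  obtain ⟨k, hk⟩ := hf
  refine ⟨BoundedContinuousFunction.ofNormedAddCommGroup f f.continuous ‖k.toBCF‖ fun x => ?_,
    ⟨hcov, k, hk⟩, fun x => rfl⟩
  rw [← hk x]
  exact (le_abs_self _).trans (k.toBCF.norm_coe_le_norm (x : G ⧸ H))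

/-- The induced algebra is norm closed, hence a C⋆-algebra. -/
instance isClosed_inducedAlgebra : IsClosed (inducedAlgebra α : Set (G →ᵇ D)) := by
  rw [← isSeqClosed_iff_isClosed]
  intro F f hF hlim
  have hpt : ∀ x, Tendsto (fun n => F n x) atTop (𝓝 (f x)) := fun x =>
    ((continuous_eval_const (F := G →ᵇ D) x).tendsto f).comp hlim
  have hc : ∀ (x : G) (h : H), f (x - h) = α h (f x) := by
    intro x h
    refine tendsto_nhds_unique (hpt (x - h)) ?_
    have := ((StarAlgEquiv.isometry (α h)).continuous.tendsto (f x)).comp (hpt x)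
    exact this.congr fun n => ((hF n).1 x h).symm
  refine ⟨hc, (exists_C0_iff α f.continuous hc).2 ?_⟩
  rw [Metric.tendsto_nhds]
  intro ε hε
  obtain ⟨n, hn⟩ := ((Metric.tendsto_nhds.1 hlim) (ε / 2) (half_pos hε)).exists
  have h1 := (exists_C0_iff α (F n).continuous (hF n).1).1 (hF n).2
  filter_upwards [(Metric.tendsto_nhds.1 h1) (ε / 2) (half_pos hε)] with x hx
  have h2 : ‖F n x - f x‖ < ε / 2 := by
    rw [← dist_eq_norm]; exact (BoundedContinuousFunction.dist_coe_le_dist x).trans_lt hn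
  simp only [dist_zero_right, norm_norm] at hx ⊢
  calc ‖f x‖ = ‖F n x - (F n x - f x)‖ := by rw [sub_sub_cancel]
    _ ≤ ‖F n x‖ + ‖F n x - f x‖ := norm_sub_le _ _
    _ < ε := by linarith

/-- Evaluation at `0`, the homomorphism `π : ind_H^G(D, α) → D`, `π(f) = f(0)`. -/
def evalZero : inducedAlgebra α →⋆ₙₐ[ℂ] D where
  toFun f := (f : G →ᵇ D) 0
  map_smul' _ _ := rfl
  map_zero' := rfl
  map_add' _ _ := rfl
  map_mul' _ _ := rfl
  map_star' _ := rfl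

/-- The function `x ↦ f(x - g)` for `f` in the induced algebra. -/
def translateFun (g : G) (f : inducedAlgebra α) : inducedAlgebra α :=
  ⟨(f : G →ᵇ D).compContinuous ⟨fun x => x - g, by fun_prop⟩, by
    obtain ⟨f, hf, k, hk⟩ := f
    refine ⟨fun x h => ?_, k.comp (Homeomorph.subRight (g : G ⧸ H)).toCocompactMap, fun x => ?_⟩
    · change f (x - h - g) = α h (f (x - g))
      rw [sub_right_comm, hf]
    · exact hk (x - g)⟩

/-- The translation action `β` of `G` on the induced algebra: `β_g(f)(x) = f(x - g)`. -/
def translation (g : G) : inducedAlgebra α ≃⋆ₐ[ℂ] inducedAlgebra α where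
  toFun := translateFun α g
  invFun := translateFun α (-g)
  left_inv f := by
    ext x
    change (f : G →ᵇ D) (x - -g - g) = (f : G →ᵇ D) x
    simp
  right_inv f := by
    ext x
    change (f : G →ᵇ D) (x - g - -g) = (f : G →ᵇ D) x
    simp
  map_mul' _ _ := rfl
  map_add' _ _ := rfl
  map_star' _ := rfl
  map_smul' _ _ := rfl

theorem translation_apply (g x : G) (f : inducedAlgebra α) :
    (translation α g f : G →ᵇ D) x = (f : G →ᵇ D) (x - g) := rfl

/-- The pointwise product `x ↦ k(x + H) f(x)` of `k ∈ C₀(G/H)` and `f` in the induced algebra. -/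
def mulC0Fun (k : C₀(G ⧸ H, ℂ)) (f : inducedAlgebra α) : inducedAlgebra α :=
  ⟨BoundedContinuousFunction.ofNormedAddCommGroup
      (fun x : G => k (x : G ⧸ H) • (f : G →ᵇ D) x)
      ((k.continuous.comp QuotientAddGroup.continuous_mk).smul (f : G →ᵇ D).continuous)
      (‖k‖ * ‖f‖) (fun x => by
        rw [norm_smul]
        exact mul_le_mul (k.toBCF.norm_coe_le_norm (x : G ⧸ H))
          ((f : G →ᵇ D).norm_coe_le_norm x) (norm_nonneg _) (norm_nonneg _)), by
    obtain ⟨f, hf⟩ := f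
    have hc : ∀ (x : G) (h : H), k ((x - h : G) : G ⧸ H) • f (x - h)
        = α h (k (x : G ⧸ H) • f x) := by
      intro x h
      have hx : ((x - h : G) : G ⧸ H) = (x : G ⧸ H) := by
        rw [QuotientAddGroup.mk_sub, (QuotientAddGroup.eq_zero_iff (h : G)).2 h.2, sub_zero]
      rw [hx, hf.1, map_smul]
    have hcont : Continuous fun x : G => k (x : G ⧸ H) • f x :=
      (k.continuous.comp QuotientAddGroup.continuous_mk).smul f.continuous
    refine ⟨hc, (exists_C0_iff α hcont hc).2 ?_⟩
    have h1 := ((exists_C0_iff α f.continuous hf.1).1 hf.2).const_mul ‖k‖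
    rw [mul_zero] at h1
    refine squeeze_zero (fun x => norm_nonneg _) (fun x => ?_) h1
    rw [norm_smul]
    exact mul_le_mul_of_nonneg_right (k.toBCF.norm_coe_le_norm (x : G ⧸ H)) (norm_nonneg _)⟩

theorem mulC0Fun_apply (k : C₀(G ⧸ H, ℂ)) (f : inducedAlgebra α) (x : G) :
    (mulC0Fun α k f : G →ᵇ D) x = k (x : G ⧸ H) • (f : G →ᵇ D) x := rfl

/-- Pointwise multiplication by `k ∈ C₀(G/H)` as a bounded operator on the induced algebra. -/
def mulC0CLM (k : C₀(G ⧸ H, ℂ)) : inducedAlgebra α →L[ℂ] inducedAlgebra α :=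
  LinearMap.mkContinuous
    { toFun := mulC0Fun α k
      map_add' := fun f g => by
        ext x; exact smul_add (k (x : G ⧸ H)) ((f : G →ᵇ D) x) ((g : G →ᵇ D) x)
      map_smul' := fun c f => by
        ext x; exact smul_comm (k (x : G ⧸ H)) c ((f : G →ᵇ D) x) }
    ‖k‖ (fun f => (BoundedContinuousFunction.norm_le (f := (mulC0Fun α k f : G →ᵇ D))
      (by positivity)).2 fun x => by
        rw [mulC0Fun_apply, norm_smul]
        exact mul_le_mul (k.toBCF.norm_coe_le_norm (x : G ⧸ H))
          ((f : G →ᵇ D).norm_coe_le_norm x) (norm_nonneg _) (norm_nonneg _))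

theorem mulC0CLM_apply (k : C₀(G ⧸ H, ℂ)) (f : inducedAlgebra α) (x : G) :
    (mulC0CLM α k f : G →ᵇ D) x = k (x : G ⧸ H) • (f : G →ᵇ D) x := rfl

/-- The homomorphism `j : C₀(G/H) → M(ind_H^G(D, α))` given by pointwise multiplication. -/
def mulC0 : C₀(G ⧸ H, ℂ) →⋆ₙₐ[ℂ] 𝓜(ℂ, inducedAlgebra α) where
  toFun k :=
    { fst := mulC0CLM α k
      snd := mulC0CLM α k
      central := fun f g => by
        ext x
        change (k (x : G ⧸ H) • (f : G →ᵇ D) x) * (g : G →ᵇ D) x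
          = (f : G →ᵇ D) x * (k (x : G ⧸ H) • (g : G →ᵇ D) x)
        rw [smul_mul_assoc, mul_smul_comm] }
  map_smul' c k := by
    apply DoubleCentralizer.ext
    refine Prod.ext ?_ ?_ <;>
    · ext f x
      exact smul_assoc c (k (x : G ⧸ H)) ((f : G →ᵇ D) x)
  map_zero' := by
    apply DoubleCentralizer.ext
    refine Prod.ext ?_ ?_ <;>
    · ext f x
      exact zero_smul ℂ ((f : G →ᵇ D) x)
  map_add' k l := by
    apply DoubleCentralizer.ext
    refine Prod.ext ?_ ?_ <;>
    · ext f x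
      exact add_smul (k (x : G ⧸ H)) (l (x : G ⧸ H)) ((f : G →ᵇ D) x)
  map_mul' k l := by
    apply DoubleCentralizer.ext
    refine Prod.ext ?_ ?_
    · ext f x
      exact mul_smul (k (x : G ⧸ H)) (l (x : G ⧸ H)) ((f : G →ᵇ D) x)
    · ext f x
      change (k (x : G ⧸ H) * l (x : G ⧸ H)) • (f : G →ᵇ D) x
        = l (x : G ⧸ H) • k (x : G ⧸ H) • (f : G →ᵇ D) x
      rw [mul_comm, mul_smul]
  map_star' k := by
    apply DoubleCentralizer.ext
    refine Prod.ext ?_ ?_ <;>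
    · ext f x
      change star (k (x : G ⧸ H)) • (f : G →ᵇ D) x
        = star (k (x : G ⧸ H) • star ((f : G →ᵇ D) x))
      rw [star_smul, star_star]

end

end

end InducedAlgebra

namespace InducedAlgebra

/-! Equivariance and `π ∘ Ψ = ρ` leave no choice: `Ψ(e)(x) = π(β_{-x}(Ψ(e))) = ρ(γ_{-x}(e))`, which
settles uniqueness. Conditions (ii) and (iv) put this function in the induced algebra
(`exists_orbitMap`), and (iii) makes the resulting homomorphism injective, hence isometric with
closed range.

Surjectivity is therefore a matter of density. By (i) and the equivariance of `i`, the range is a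
`C₀(G/H)`-submodule; since `ρ` is onto, its elements take every value of `D` at each point. A
partition of unity on `G/H` glues local approximations inside such a subspace
(`closure_eq_univ_of_mulC0_mem`). -/

theorem CStarAction.add_apply {G A : Type*} [AddGroup G] [TopologicalSpace G]
    [NonUnitalCStarAlgebra A] (γ : CStarAction G A)
    (g h : G) (a : A) : γ (g + h) a = γ g (γ h a) := by
  rw [γ.map_add]; rfl

theorem CStarAction.zero_apply {G A : Type*} [AddGroup G] [TopologicalSpace G]
    [NonUnitalCStarAlgebra A] (γ : CStarAction G A)
    (a : A) : γ 0 a = a := by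
  rw [γ.map_zero]; rfl

section

variable {G : Type*} [AddCommGroup G] [TopologicalSpace G] [IsTopologicalAddGroup G]
variable {H : AddSubgroup G} {D : Type*} [NonUnitalCStarAlgebra D] (α : CStarAction H D)

/-! ### Density of `C₀(G/H)`-submodules with full fibres -/

/-- A complex-valued `C₀` function from a compactly supported real-valued one. -/
noncomputable def c0OfCompactSupport {X : Type*} [TopologicalSpace X] (φ : C(X, ℝ))
    (hφ : HasCompactSupport φ) : C₀(X, ℂ) where
  toFun x := (φ x : ℂ)
  continuous_toFun := Complex.continuous_ofReal.comp φ.continuous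
  zero_at_infty' := by
    have h : HasCompactSupport fun x => (φ x : ℂ) :=
      hφ.comp_left (g := Complex.ofReal) Complex.ofReal_zero
    exact h.is_zero_at_infty

/-- A linear subspace of the induced algebra which is a `C₀(G/H)`-submodule and whose fibres
are everything is dense. -/
theorem closure_eq_univ_of_mulC0_mem [LocallyCompactSpace G] (hH : IsClosed (H : Set G))
    (S : Submodule ℂ (inducedAlgebra α))
    (hmul : ∀ (k : C₀(G ⧸ H, ℂ)), ∀ s ∈ S, mulC0Fun α k s ∈ S)
    (heval : ∀ (x : G) (d : D), ∃ s ∈ S, (s : G →ᵇ D) x = d) :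
    closure (S : Set (inducedAlgebra α)) = Set.univ := by
  -- As an instance, this makes `G ⧸ H` Hausdorff, as the partition of unity requires.
  have : IsClosed (H : Set G) := hH
  refine Set.eq_univ_of_forall fun f => Metric.mem_closure_iff.2 fun ε hε => ?_
  obtain ⟨kf, hkf⟩ := f.2.2
  -- The norm of `s - f` descends to a continuous `k s` on `G ⧸ H`, so closeness of `s` to `f` is an
  -- open condition there.
  choose k hk using fun s : S => ((s : inducedAlgebra α) - f).2.2
  have hkK : ∀ᶠ z in cocompact (G ⧸ H), kf z < ε / 2 :=
    kf.zero_at_infty'.eventually_lt_const (half_pos hε)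
  obtain ⟨K, hK, hKf⟩ := mem_cocompact.1 hkK
  have hopen : ∀ s : S, IsOpen {z | k s z < ε / 2} := fun s =>
    isOpen_lt (k s).continuous continuous_const
  obtain ⟨t, ht⟩ := hK.elim_finite_subcover (fun s : S => {z | k s z < ε / 2}) hopen (by
    intro z _
    obtain ⟨x, rfl⟩ := QuotientAddGroup.mk_surjective z
    obtain ⟨s, hs, hsx⟩ := heval x ((f : G →ᵇ D) x)
    refine Set.mem_iUnion.2 ⟨⟨s, hs⟩, ?_⟩
    have h0 : ((s - f : inducedAlgebra α) : G →ᵇ D) x = 0 := by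
      change (s : G →ᵇ D) x - (f : G →ᵇ D) x = 0
      rw [hsx, sub_self]
    change k ⟨s, hs⟩ (x : G ⧸ H) < ε / 2
    rw [hk, h0, norm_zero]
    exact half_pos hε)
  obtain ⟨φ, hφ, hφc⟩ := PartitionOfUnity.exists_isSubordinate_of_locallyFinite_t2space hK
    (fun s : t => {z | k s z < ε / 2}) (fun s => hopen s) (locallyFinite_of_finite _)
    (fun z hz => by
      obtain ⟨s, hs, hz⟩ := Set.mem_iUnion₂.1 (ht hz)
      exact Set.mem_iUnion.2 ⟨⟨s, hs⟩, hz⟩)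
  let g : inducedAlgebra α :=
    ∑ s : t, mulC0Fun α (c0OfCompactSupport (φ s) (hφc s)) (s : S)
  have hg : ∀ x, (g : G →ᵇ D) x =
      ∑ s : t, (φ s (x : G ⧸ H) : ℂ) • ((s : S) : G →ᵇ D) x := by
    intro x
    simp only [g, AddSubmonoidClass.coe_finsetSum, BoundedContinuousFunction.sum_apply]
    rfl
  refine ⟨g, S.sum_mem fun s _ => hmul _ _ (s : S).2, ?_⟩
  rw [dist_comm, dist_eq_norm]
  -- Pointwise bounds control the supremum norm only up to `≤`; aiming at `ε / 2` recovers the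
  -- strict inequality.
  refine lt_of_le_of_lt ?_ (half_lt_self hε)
  refine (BoundedContinuousFunction.norm_le (f := ((g - f : inducedAlgebra α) : G →ᵇ D))
    (half_pos hε).le).2 fun x => ?_
  have hsum : ∑ s : t, φ s (x : G ⧸ H) ≤ 1 := by
    rw [← finsum_eq_sum_of_fintype]
    exact φ.sum_le_one (x : G ⧸ H)
  -- The weights `φ s` and `1 - ∑ φ s` are nonnegative with sum `1`. Where `φ s` is nonzero, `s - f`
  -- is below `ε / 2`; the last weight vanishes on `K`, and off `K` the function `f` itself is below
  -- `ε / 2`.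
  have hdecomp : ((g - f : inducedAlgebra α) : G →ᵇ D) x =
      ∑ s : t, (φ s (x : G ⧸ H) : ℂ) • (((s : S) - f : inducedAlgebra α) : G →ᵇ D) x -
        ((1 - ∑ s : t, φ s (x : G ⧸ H) : ℝ) : ℂ) • (f : G →ᵇ D) x := by
    change (g : G →ᵇ D) x - (f : G →ᵇ D) x =
      ∑ s : t, (φ s (x : G ⧸ H) : ℂ) • (((s : S) : G →ᵇ D) x - (f : G →ᵇ D) x) - _
    rw [hg]
    simp only [smul_sub, Finset.sum_sub_distrib, ← Finset.sum_smul]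
    push_cast
    rw [sub_smul, one_smul]
    abel
  have hterm : ∀ s : t, ‖(φ s (x : G ⧸ H) : ℂ) •
      (((s : S) - f : inducedAlgebra α) : G →ᵇ D) x‖ ≤ φ s (x : G ⧸ H) * (ε / 2) := by
    intro s
    rw [norm_smul, Complex.norm_real, Real.norm_of_nonneg (φ.nonneg s _), ← hk]
    by_cases h : φ s (x : G ⧸ H) = 0
    · simp [h]
    · exact mul_le_mul_of_nonneg_left (le_of_lt (hφ s (subset_tsupport _ h))) (φ.nonneg s _)
  have hrest : ‖((1 - ∑ s : t, φ s (x : G ⧸ H) : ℝ) : ℂ) • (f : G →ᵇ D) x‖ ≤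
      (1 - ∑ s : t, φ s (x : G ⧸ H)) * (ε / 2) := by
    rw [norm_smul, Complex.norm_real, Real.norm_of_nonneg (sub_nonneg.2 hsum), ← hkf]
    by_cases hx : (x : G ⧸ H) ∈ K
    · have h1 : ∑ s : t, φ s (x : G ⧸ H) = 1 := by
        rw [← finsum_eq_sum_of_fintype]
        exact φ.sum_eq_one hx
      rw [h1, sub_self, zero_mul, zero_mul]
    · exact mul_le_mul_of_nonneg_left (le_of_lt (hKf hx)) (sub_nonneg.2 hsum)
  rw [hdecomp]
  calc _ ≤ _ := norm_sub_le _ _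
    _ ≤ ∑ s : t, φ s (x : G ⧸ H) * (ε / 2) + (1 - ∑ s : t, φ s (x : G ⧸ H)) * (ε / 2) :=
      add_le_add ((norm_sum_le _ _).trans (Finset.sum_le_sum fun s _ => hterm s)) hrest
    _ = ε / 2 := by rw [← Finset.sum_mul]; ring

/-! ### The orbit homomorphism from `E` to the induced algebra -/

theorem multiplierAut_fst_apply {A : Type*} [NonUnitalCStarAlgebra A] (φ : A ≃⋆ₐ[ℂ] A)
    (m : 𝓜(ℂ, A)) (a : A) : (multiplierAut φ m).fst (φ a) = φ (m.fst a) := by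
  change φ (m.fst (φ.symm (φ a))) = φ (m.fst a)
  rw [StarAlgEquiv.symm_apply_apply]

variable {E : Type*} [NonUnitalCStarAlgebra E]

/-- Condition (iv) concerns `γ x`, while the orbit map uses `γ (-x)`; negation is a homeomorphism of
`G ⧸ H`, so it preserves the filter of neighbourhoods of infinity. -/
theorem tendsto_neg_comap_cocompact :
    Tendsto (fun x : G => -x) (comap (fun x : G => (x : G ⧸ H)) (cocompact (G ⧸ H)))
      (comap (fun x : G => (x : G ⧸ H)) (cocompact (G ⧸ H))) := by
  refine tendsto_comap_iff.2 ?_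
  exact (Homeomorph.neg (G ⧸ H)).isClosedEmbedding.tendsto_cocompact.comp tendsto_comap

/-- The sign in `γ (-x)` is what turns (ii) into the covariance `f(x - h) = α_h(f(x))`, because `-(x
- h) = h + (-x)`. -/
theorem exists_orbitMap (γ : CStarAction G E) (ρ : E →⋆ₙₐ[ℂ] D)
    (h2 : ∀ (h : H) (e : E), ρ (γ (h : G) e) = α h (ρ e))
    (h4 : ∀ e : E, Tendsto (fun x : G => ‖ρ (γ x e)‖)
      (comap (fun x : G => (x : G ⧸ H)) (cocompact (G ⧸ H))) (𝓝 0)) :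
    ∃ Φ : E →⋆ₙₐ[ℂ] inducedAlgebra α,
      ∀ (e : E) (x : G), (Φ e : G →ᵇ D) x = ρ (γ (-x) e) := by
  have hcont : ∀ e, Continuous fun x : G => ρ (γ (-x) e) := fun e =>
    (AddMonoidHomClass.continuous_of_bound ρ 1 fun a => by
      simpa using NonUnitalStarAlgHom.norm_apply_le ρ a).comp ((γ.continuous_apply e).comp continuous_neg)
  have hcov : ∀ (e : E) (x : G) (h : H),
      ρ (γ (-(x - h)) e) = α h (ρ (γ (-x) e)) := by
    intro e x h
    rw [neg_sub, sub_eq_add_neg, γ.add_apply, h2]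
  have hex : ∀ e : E, ∃ F ∈ inducedAlgebra α, ∀ x, F x = ρ (γ (-x) e) := fun e =>
    exists_mem_inducedAlgebra α ⟨_, hcont e⟩ (hcov e)
      ((exists_C0_iff α (hcont e) (hcov e)).2 ((h4 e).comp tendsto_neg_comap_cocompact))
  choose F hF hFx using hex
  refine ⟨{ toFun := fun e => ⟨F e, hF e⟩, map_smul' := ?_, map_zero' := ?_, map_add' := ?_,
            map_mul' := ?_, map_star' := ?_ }, hFx⟩
  · intro c e
    ext x
    change F (c • e) x = c • F e x
    simp only [hFx, map_smul]
  · ext x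
    change F 0 x = 0
    simp only [hFx, map_zero]
  · intro e e'
    ext x
    change F (e + e') x = F e x + F e' x
    simp only [hFx, map_add]
  · intro e e'
    ext x
    change F (e * e') x = F e x * F e' x
    simp only [hFx, map_mul]
  · intro e
    ext x
    change F (star e) x = star (F e x)
    simp only [hFx, map_star]

end

end InducedAlgebra

/-! ### The isomorphism and its uniqueness -/

theorem theorem2p1 {G D E : Type*}
    [AddCommGroup G] [TopologicalSpace G] [IsTopologicalAddGroup G]
    [LocallyCompactSpace G] [T2Space G]
    (H : AddSubgroup G) (hH : IsClosed (H : Set G))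
    [NonUnitalCStarAlgebra D] [NonUnitalCStarAlgebra E]
    (α : InducedAlgebra.CStarAction H D) (γ : InducedAlgebra.CStarAction G E)
    (ρ : E →⋆ₙₐ[ℂ] D) (hρ : Function.Surjective ρ)
    (i : C₀(G ⧸ H, ℂ) →⋆ₙₐ[ℂ] 𝓜(ℂ, E))
    (hi_central : ∀ k, i k ∈ Set.center 𝓜(ℂ, E))
    (hi_equivariant : ∀ g k,
      i (InducedAlgebra.translateC0 H g k) = InducedAlgebra.multiplierAut (γ g) (i k))
    (h1 : ∀ (k : C₀(G ⧸ H, ℂ)) (e : E), ρ ((i k).fst e) = k (0 : G ⧸ H) • ρ e)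
    (h2 : ∀ (h : H) (e : E), ρ (γ (h : G) e) = α h (ρ e))
    (h3 : ∀ e : E, (∀ g : G, ρ (γ g e) = 0) → e = 0)
    (h4 : ∀ e : E, Tendsto (fun x : G => ‖ρ (γ x e)‖)
      (comap (fun x : G => (x : G ⧸ H)) (cocompact (G ⧸ H))) (𝓝 0)) :
    ∃ Ψ : E ≃⋆ₐ[ℂ] InducedAlgebra.inducedAlgebra α,
      (∀ (g : G) (e : E), Ψ (γ g e) = InducedAlgebra.translation α g (Ψ e)) ∧
      (∀ e : E, InducedAlgebra.evalZero α (Ψ e) = ρ e) ∧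
      (∀ (k : C₀(G ⧸ H, ℂ)) (e : E),
        (InducedAlgebra.mulC0 α k).fst (Ψ e) = Ψ ((i k).fst e)) ∧
      ∀ Ψ' : E ≃⋆ₐ[ℂ] InducedAlgebra.inducedAlgebra α,
        (∀ (g : G) (e : E), Ψ' (γ g e) = InducedAlgebra.translation α g (Ψ' e)) →
        (∀ e : E, InducedAlgebra.evalZero α (Ψ' e) = ρ e) →
        Ψ' = Ψ := by
  obtain ⟨Φ, hΦ⟩ := InducedAlgebra.exists_orbitMap α γ ρ h2 h4
  have hmul : ∀ (k : C₀(G ⧸ H, ℂ)) (e : E),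
      InducedAlgebra.mulC0Fun α k (Φ e) = Φ ((i k).fst e) := by
    intro k e
    ext x
    -- Moving `γ (-x)` past `i k` replaces `k` by its translate by `-x`, whose value at the trivial
    -- coset, extracted by (i), is `k(x + H)`.
    rw [InducedAlgebra.mulC0Fun_apply, hΦ, hΦ, ← InducedAlgebra.multiplierAut_fst_apply,
      ← hi_equivariant, h1]
    congr 1
    change _ = InducedAlgebra.translateC0 H (-x) k ((0 : G) : G ⧸ H)
    rw [InducedAlgebra.translateC0_apply, zero_sub, neg_neg]
  have hinj : Function.Injective Φ := by
    refine (injective_iff_map_eq_zero Φ).2 fun e he => h3 e fun g => ?_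
    have := hΦ e (-g)
    rw [he, neg_neg] at this
    exact this.symm
  have hsurj : Function.Surjective Φ := by
    have hclosed : IsClosed (Set.range Φ) :=
      (NonUnitalStarAlgHom.isometry Φ hinj).isClosedEmbedding.isClosed_range
    have hdense := InducedAlgebra.closure_eq_univ_of_mulC0_mem α hH
      (LinearMap.range (Φ : E →ₗ[ℂ] InducedAlgebra.inducedAlgebra α))
      (by
        rintro k _ ⟨e, rfl⟩
        exact ⟨(i k).fst e, (hmul k e).symm⟩)
      (by
        intro x d
        obtain ⟨e, rfl⟩ := hρ d
        -- The value at `x` of the image of `γ x e` is `ρ (γ (-x) (γ x e)) = ρ e`.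
        refine ⟨_, ⟨γ x e, rfl⟩, (hΦ _ _).trans ?_⟩
        rw [← γ.add_apply, neg_add_cancel, γ.zero_apply])
    exact Set.range_eq_univ.1 (hclosed.closure_eq.symm.trans hdense)
  refine ⟨StarAlgEquiv.ofBijective Φ ⟨hinj, hsurj⟩, fun g e => ?_, fun e => ?_,
    fun k e => hmul k e, fun Ψ' hequiv hev => ?_⟩
  · ext x
    change (Φ (γ g e) : G →ᵇ D) x = (Φ e : G →ᵇ D) (x - g)
    rw [hΦ, hΦ, ← γ.add_apply, neg_sub, neg_add_eq_sub]
  · change (Φ e : G →ᵇ D) 0 = ρ e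
    rw [hΦ, neg_zero, γ.zero_apply]
  · ext e x
    change (Ψ' e : G →ᵇ D) x = (Φ e : G →ᵇ D) x
    -- Translating by `-x` brings the value at `x` to `0`, where `evalZero` reads it.
    have h : (InducedAlgebra.translation α (-x) (Ψ' e) : G →ᵇ D) 0 = ρ (γ (-x) e) := by
      rw [← hequiv]
      exact hev _
    rw [InducedAlgebra.translation_apply, zero_sub, neg_neg] at h
    rw [h, hΦ]
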